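/- Let $\Sigma$ and $\Delta$ be finite sets of function and predicate symbols with arities, where $\Sigma$ contains at least one constant, and let $\mathcal{V}$ be an infinite set of variables. For a set $F$ of function symbols, $\mathcal{T}(F,\mathcal{V})$ and $\mathcal{T}^\infty(F,\mathcal{V})$ denote the finite and the possibly infinite terms over $F$. A term is rational if it has only finitely many different subterms, and an atom $p(\vec t)$ is rational if all its arguments are. \emph{Logic programs.} A logic program $\mathcal{P}$ is a finite set of clauses $H \,\text{:-}\, B_1,\dots,B_k$ ($k\ge 0$) of atoms with finite argument terms. A query is a finite sequence of atoms with possibly infinite argument terms. Substitutions are arbitrary maps $\mathcal{V}\to\mathcal{T}^\infty(\Sigma,\mathcal{V})$; $\theta$ is an mgu of two atoms if it unifies them and every unifier is of the form $\theta\mu$ for a substitution $\mu$ (no occurs check). A resolution step leads from $A_1,\dots,A_m$ to $(B_1,\dots,B_k,A_2,\dots,A_m)\theta$, where $H\,\text{:-}\,B_1,\dots,B_k$ is a fresh variant of a clause of $\mathcal{P}$ and $\theta$ is an mgu of $A_1$ and $H$. A query terminates for $\mathcal{P}$ if it does not start an infinite sequence of resolution steps. \emph{Rewriting.} A TRS $\mathcal{R}$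 is a finite set of rules $\ell\to r$ of finite terms where $\ell$ is not a variable. Its defined symbols are the root symbols of its left-hand sides; all other symbols of the signature are constructors. For each defined symbol $f/n$ the signature is extended by a fresh constructor $f^\sharp/n$ (a tuple symbol), and $f(\vec t)^\sharp = f^\sharp(\vec t)$. We write $s\to_{\mathcal{R}}t$ if $t$ results from $s$ by replacing a subterm $\ell\sigma$ at some position by $r\sigma$, where $\ell\to r\in\mathcal{R}$ and $\sigma$ maps variables to possibly infinite terms without defined symbols. Let $DP(\mathcal{R})=\{\ell^\sharp\to t^\sharp \mid \ell\to r\in\mathcal{R},\ t \text{ a subterm of } r \text{ with defined root symbol}\}$. \emph{The TRS $\mathcal{R}_{\mathcal{P}}$.} Its signature $\Sigma_{\mathcal{P}}$ consists of $\Sigma$, symbols $p_{in}/n$ and $p_{out}/n$ for every $p/n\in\Delta$, and symbols $u_{c,i}$ for every clause $c\in\mathcal{P}$ with $k$ body atoms and every $1\le i\le k$. For a fact $p(\vec s)$ it has the rule $p_{in}(\vec s)\to p_{out}(\vec s)$. For a clause $c$ of the form $p(\vec s)\,\text{:-}\,p_1(\vec s_1),\dots,p_k(\vec s_k)$ with $k\ge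 1$, let $\mathcal{V}_i=\mathcal{V}(\vec s)\cup\mathcal{V}(\vec s_1)\cup\dots\cup\mathcal{V}(\vec s_i)$, listed in some fixed order; then it has the rules $p_{in}(\vec s)\to u_{c,1}(p_{1,in}(\vec s_1),\mathcal{V}_0)$, $\ u_{c,i}(p_{i,out}(\vec s_i),\mathcal{V}_{i-1})\to u_{c,i+1}(p_{i+1,in}(\vec s_{i+1}),\mathcal{V}_i)$ for $1\le i<k$, and $u_{c,k}(p_{k,out}(\vec s_k),\mathcal{V}_{k-1})\to p_{out}(\vec s)$. \emph{Filters and chains.} An argument filter $\pi$ maps every symbol $f/n$ to a subset of $\{1,\dots,n\}$. It extends to terms and atoms by $\pi(x)=x$ for variables $x$ and $\pi(f(t_1,\dots,t_n))=f(\pi(t_{i_1}),\dots,\pi(t_{i_k}))$ if $\pi(f)=\{i_1<\dots<i_k\}$, and to TRSs by $\pi(\mathcal{R})=\{\pi(\ell)\to\pi(r)\mid \ell\to r\in\mathcal{R}\}$. A filter $\pi'$ is a refinement of $\pi$ if $\pi'(f)\subseteq\pi(f)$ for all $f$. A TRS satisfies the variable condition if every variable of $r$ occurs in $\ell$ for each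 of its rules $\ell\to r$. An infinite $(\mathcal{D},\mathcal{R},\pi)$-chain is an infinite sequence of pairs $s_1\to t_1,\ s_2\to t_2,\ \dots$ from $\mathcal{D}$ for which there are substitutions $\sigma_1,\sigma_2,\dots$ into possibly infinite terms without defined symbols of $\mathcal{R}$ such that, for all $i$, $\pi(s_i\sigma_i)$ and $\pi(t_i\sigma_i)$ are finite ground terms and there is a rewrite sequence $t_i\sigma_i=q_0\to_{\mathcal{R}}\dots\to_{\mathcal{R}}q_m=s_{i+1}\sigma_{i+1}$ ($m\ge0$) in which every $\pi(q_j)$ is a finite ground term. \textbf{Theorem.} Let $\mathcal{P}$ be a logic program and let $\pi$ be an argument filter over $(\Sigma,\Delta)$. Extend $\pi$ to $\Sigma_{\mathcal{P}}$ and to the tuple symbols of $\mathcal{R}_{\mathcal{P}}$ by $\pi(p_{in})=\pi(p_{in}^\sharp)=\pi(p)$ for all $p\in\Delta$ and $\pi(f)=\{1,\dots,n\}$ for all other new symbols $f/n$. Let $\pi'$ be a refinement of $\pi$ such that $\pi'(DP(\mathcal{R}_{\mathcal{P}}))$ and $\pi'(\mathcal{R}_{\mathcal{P}})$ satisfy the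 variable condition. If there is no infinite $(DP(\mathcal{R}_{\mathcal{P}}),\mathcal{R}_{\mathcal{P}},\pi')$-chain, then every query that consists of a single rational atom $Q$ over $(\Sigma,\Delta)$ for which $\pi(Q)$ is a finite ground atom terminates for $\mathcal{P}$. -/

import Mathlib

namespace LPTermination

universe u u' v w

/-- A set of symbols with arities. Argument position `i` (for `1 ≤ i ≤ n`) of an `n`-ary symbol is
represented by the element `i - 1` of `Fin n`. -/
structure Signature where
  Sym : Type u
  arity : Sym → ℕ

/-! ### Terms: finite terms (inductive), possibly infinite terms (coinductive) -/

/-- The node shapes of a term tree: a leaf labelled by a variable, or a node labelled by a symbol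
`f` with `arity f` children. -/
def termShape (S : Signature.{u}) (V : Type v) : PFunctor.{max u v, 0} where
  A := V ⊕ S.Sym
  B a := Fin (Sum.elim (fun _ => 0) S.arity a)

/-- The set `𝒯^∞(S, V)` of all (finite or infinite) terms. -/
def Term (S : Signature.{u}) (V : Type v) : Type (max u v) := (termShape S V).M

/-- The set `𝒯(S, V)` of all finite terms. -/
inductive FinTerm (S : Signature.{u}) (V : Type v) : Type (max u v)
  | var (x : V) : FinTerm S V
  | app (f : S.Sym) (ts : Fin (S.arity f) → FinTerm S V) : FinTerm S V

/-- Substitutions `V → 𝒯^∞(S, V)`; infinitely many variables may be moved. -/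
abbrev Subst (S : Signature.{u}) (V : Type v) := V → Term S V

namespace Term

variable {S : Signature.{u}} {V : Type v}

def var (x : V) : Term S V :=
  PFunctor.M.mk (F := termShape S V) ⟨Sum.inl x, Fin.elim0⟩

def app (f : S.Sym) (ts : Fin (S.arity f) → Term S V) : Term S V :=
  PFunctor.M.mk (F := termShape S V) ⟨Sum.inr f, ts⟩

theorem exists_rep (t : Term S V) : (∃ x, t = var x) ∨ ∃ f ts, t = app f ts := by
  rcases h : PFunctor.M.dest t with ⟨a | f, ts⟩
  · left
    refine ⟨a, ?_⟩
    rw [← PFunctor.M.mk_dest t, h]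
    unfold var
    congr 2
    exact funext fun i => Fin.elim0 i
  · right
    refine ⟨f, ts, ?_⟩
    rw [← PFunctor.M.mk_dest t, h]
    rfl

theorem dest_var (x : V) :
    PFunctor.M.dest (var x : Term S V) = ⟨Sum.inl x, Fin.elim0⟩ := PFunctor.M.dest_mk _

theorem dest_app (f : S.Sym) (ts : Fin (S.arity f) → Term S V) :
    PFunctor.M.dest (app f ts) = ⟨Sum.inr f, ts⟩ := PFunctor.M.dest_mk _

/-- `IsSubterm s t`: `s` is the subterm of `t` at some position. -/
inductive IsSubterm (s : Term S V) : Term S V → Prop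
  | refl : IsSubterm s s
  | arg (f : S.Sym) (ts : Fin (S.arity f) → Term S V) (i : Fin (S.arity f)) :
      IsSubterm s (ts i) → IsSubterm s (app f ts)

/-- The set `𝒱(t)` of variables occurring in `t`. -/
def vars (t : Term S V) : Set V := {x | IsSubterm (var x) t}

/-- The set of symbols occurring in `t`. -/
def syms (t : Term S V) : Set S.Sym := {f | ∃ ts, IsSubterm (app f ts) t}

/-- All paths of the tree are finite. -/
inductive IsFinite : Term S V → Prop
  | var (x : V) : IsFinite (var x)
  | app (f : S.Sym) (ts : Fin (S.arity f) → Term S V) :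
      (∀ i, IsFinite (ts i)) → IsFinite (app f ts)

/-- Only finitely many different subterms. -/
def IsRational (t : Term S V) : Prop := {s | IsSubterm s t}.Finite

def IsGround (t : Term S V) : Prop := t.vars = ∅

/-- One step of the corecursive definition of `subst`: subterms marked `Sum.inl` still have to be
instantiated, subterms marked `Sum.inr` are copied. -/
def substStep (σ : Subst S V) :
    Term S V ⊕ Term S V → (termShape S V).Obj (Term S V ⊕ Term S V)
  | Sum.inr t => (termShape S V).map Sum.inr (PFunctor.M.dest t)
  | Sum.inl t =>
    match PFunctor.M.dest t with
    | ⟨Sum.inl x, _⟩ => (termShape S V).map Sum.inr (PFunctor.M.dest (σ x))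
    | ⟨Sum.inr f, ts⟩ => ⟨Sum.inr f, fun i => Sum.inl (ts i)⟩

/-- The instance `tσ`; see `subst_var` and `subst_app`. -/
def subst (σ : Subst S V) (t : Term S V) : Term S V :=
  PFunctor.M.corec (substStep σ) (Sum.inl t)

theorem corec_substStep_inr (σ : Subst S V) (t : Term S V) :
    PFunctor.M.corec (substStep σ) (Sum.inr t) = t := by
  refine PFunctor.M.bisim (P := termShape S V)
    (fun a b => a = PFunctor.M.corec (substStep σ) (Sum.inr b)) ?_ _ _ rfl
  rintro a b rfl
  refine ⟨(PFunctor.M.dest b).1,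
    fun i => PFunctor.M.corec (substStep σ) (Sum.inr ((PFunctor.M.dest b).2 i)),
    (PFunctor.M.dest b).2, ?_, rfl, fun i => rfl⟩
  rw [PFunctor.M.dest_corec]
  rfl

@[simp] theorem subst_var (σ : Subst S V) (x : V) : (var x : Term S V).subst σ = σ x := by
  unfold subst
  rw [← PFunctor.M.mk_dest (PFunctor.M.corec _ _), PFunctor.M.dest_corec]
  simp only [substStep, dest_var]
  have h : ∀ o : (termShape S V).Obj (Term S V),
      (termShape S V).map (PFunctor.M.corec (substStep σ)) ((termShape S V).map Sum.inr o) = o := by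
    rintro ⟨a, g⟩
    exact congrArg (Sigma.mk a) (funext fun i => corec_substStep_inr σ (g i))
  exact (congrArg PFunctor.M.mk (h _)).trans (PFunctor.M.mk_dest _)

@[simp] theorem subst_app (σ : Subst S V) (f : S.Sym) (ts : Fin (S.arity f) → Term S V) :
    (app f ts).subst σ = app f fun i => (ts i).subst σ := by
  unfold subst
  rw [← PFunctor.M.mk_dest (PFunctor.M.corec _ _), PFunctor.M.dest_corec]
  simp only [substStep, dest_app]
  rfl

end Term

namespace Subst

variable {S : Signature.{u}} {V : Type v}

/-- `θ.comp μ` is `θμ`: apply `θ` first, then `μ`. -/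
def comp (θ μ : Subst S V) : Subst S V := fun x => (θ x).subst μ

end Subst

/-- An arity preserving map of symbols. -/
structure SigHom (S : Signature.{u}) (S' : Signature.{u'}) where
  toFun : S.Sym → S'.Sym
  arity_eq : ∀ f, S'.arity (toFun f) = S.arity f

namespace FinTerm

variable {S : Signature.{u}} {V : Type v}

/-- A finite term, regarded as a possibly infinite term. -/
def toTerm : FinTerm S V → Term S V
  | var x => Term.var x
  | app f ts => Term.app f fun i => (ts i).toTerm

/-- The variables of a term, from left to right, with repetitions. -/
def vars : FinTerm S V → List V
  | var x => [x]
  | app _ ts => (List.ofFn fun i => (ts i).vars).flatten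

def rename (e : V → V) : FinTerm S V → FinTerm S V
  | var x => var (e x)
  | app f ts => app f fun i => (ts i).rename e

inductive IsSubterm (s : FinTerm S V) : FinTerm S V → Prop
  | refl : IsSubterm s s
  | arg (f : S.Sym) (ts : Fin (S.arity f) → FinTerm S V) (i : Fin (S.arity f)) :
      IsSubterm s (ts i) → IsSubterm s (app f ts)

/-- The same term, regarded as a term over a larger signature. -/
def mapSym {S' : Signature.{u'}} (φ : SigHom S S') : FinTerm S V → FinTerm S' V
  | var x => var x
  | app f ts => app (φ.toFun f) fun i => (ts (Fin.cast (φ.arity_eq f) i)).mapSym φ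

end FinTerm

/-! ### Logic programs -/

/-- An atom `p(t₁, …, tₙ)` with arguments in `T` (finite terms or possibly infinite terms). -/
structure Atom (D : Signature.{u'}) (T : Type w) where
  pred : D.Sym
  args : Fin (D.arity pred) → T

namespace Atom

variable {D : Signature.{u'}} {S : Signature.{u}} {V : Type v} {T : Type w}

def map {T' : Type*} (g : T → T') (A : Atom D T) : Atom D T' := ⟨A.pred, fun i => g (A.args i)⟩

/-- The variables of a finite atom, from left to right, with repetitions. -/
def varList (A : Atom D (FinTerm S V)) : List V := (List.ofFn fun i => (A.args i).vars).flatten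

def vars (A : Atom D (Term S V)) : Set V := {x | ∃ i, x ∈ (A.args i).vars}

def subst (θ : Subst S V) (A : Atom D (Term S V)) : Atom D (Term S V) := A.map (Term.subst θ)

def toInf (A : Atom D (FinTerm S V)) : Atom D (Term S V) := A.map FinTerm.toTerm

def IsRational (A : Atom D (Term S V)) : Prop := ∀ i, (A.args i).IsRational

/-- A finite atom without variables. -/
def IsFiniteGround (A : Atom D (Term S V)) : Prop :=
  ∀ i, (A.args i).IsFinite ∧ (A.args i).IsGround

end Atom

/-- A clause `H :- B₁, …, Bₖ` (with `k ≥ 0`) consisting of finite atoms. -/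
structure Clause (S : Signature.{u}) (D : Signature.{u'}) (V : Type v) where
  head : Atom D (FinTerm S V)
  body : List (Atom D (FinTerm S V))

/-- A query `A₁, …, Aₘ`. -/
abbrev Query (S : Signature.{u}) (D : Signature.{u'}) (V : Type v) := List (Atom D (Term S V))

/-- A definite logic program: a finite set of clauses. -/
structure LogicProgram (S : Signature.{u}) (D : Signature.{u'}) (V : Type v) where
  clauses : Set (Clause S D V)
  finite : clauses.Finite

section Resolution

variable {S : Signature.{u}} {D : Signature.{u'}} {V : Type v}

/-- The variant of a clause under a variable renaming, i.e. a bijection of the variables. -/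
def Clause.rename (e : Equiv.Perm V) (c : Clause S D V) : Clause S D V :=
  ⟨c.head.map (FinTerm.rename e), c.body.map (Atom.map (FinTerm.rename e))⟩

def Clause.vars (c : Clause S D V) : Set V :=
  {x | x ∈ c.head.varList ∨ ∃ B ∈ c.body, x ∈ B.varList}

def Query.vars (Q : Query S D V) : Set V := {x | ∃ A ∈ Q, x ∈ A.vars}

def IsUnifier (θ : Subst S V) (A B : Atom D (Term S V)) : Prop := A.subst θ = B.subst θ

def IsMGU (θ : Subst S V) (A B : Atom D (Term S V)) : Prop :=
  IsUnifier θ A B ∧ ∀ σ : Subst S V, IsUnifier σ A B → ∃ μ : Subst S V, σ = θ.comp μ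

/-- `Q'` is a resolvent of `Q` and `c` using `θ`. -/
def IsResolvent (Q : Query S D V) (c : Clause S D V) (θ : Subst S V) (Q' : Query S D V) : Prop :=
  ∃ (A : Atom D (Term S V)) (As : Query S D V), Q = A :: As ∧ IsMGU θ A c.head.toInf ∧
    Q' = (c.body.map Atom.toInf ++ As).map (Atom.subst θ)

/-- `Q ⊢_P Q'`. The variant of the program clause is fresh in the sense that it has no variable in
common with the query to which it is applied. (Standardizing apart also from the earlier part of
the derivation restricts the choice of the variants further, so every derivation in that sense is
a derivation here.) -/
def LogicProgram.Step (P : LogicProgram S D V) (Q Q' : Query S D V) : Prop :=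
  ∃ c ∈ P.clauses, ∃ e : Equiv.Perm V, Disjoint (c.rename e).vars (Query.vars Q) ∧
    ∃ θ : Subst S V, IsResolvent Q (c.rename e) θ Q'

/-- All derivations of `P` and `Q` are finite. -/
def LogicProgram.Terminates (P : LogicProgram S D V) (Q : Query S D V) : Prop :=
  ¬ ∃ q : ℕ → Query S D V, q 0 = Q ∧ ∀ i, P.Step (q i) (q (i + 1))

end Resolution

/-! ### Term rewrite systems and infinitary constructor rewriting -/

/-- A rule `ℓ → r` of finite terms where `ℓ = root(args)` is not a variable. -/
structure Rule (S : Signature.{u}) (V : Type v) where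
  root : S.Sym
  args : Fin (S.arity root) → FinTerm S V
  rhs : FinTerm S V

def Rule.lhs {S : Signature.{u}} {V : Type v} (ρ : Rule S V) : FinTerm S V :=
  FinTerm.app ρ.root ρ.args

/-- A set of rules. -/
abbrev TRS (S : Signature.{u}) (V : Type v) := Set (Rule S V)

namespace TRS

variable {S : Signature.{u}} {V : Type v}

/-- The defined symbols `Σ_D`. -/
def definedSyms (R : TRS S V) : Set S.Sym := {f | ∃ ρ ∈ R, ρ.root = f}

/-- The constructors `Σ_C`. -/
def constructors (R : TRS S V) : Set S.Sym := R.definedSymsᶜ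

/-- `σ : V → 𝒯^∞(Σ_C, V)`. -/
def IsConstructorSubst (R : TRS S V) (σ : Subst S V) : Prop :=
  ∀ x, (σ x).syms ⊆ R.constructors

/-- The infinitary constructor rewrite relation: `s|_pos = ℓσ` and `t = s[rσ]_pos` for some
position `pos`, rule `ℓ → r` and constructor substitution `σ`. -/
inductive Rewrites (R : TRS S V) : Term S V → Term S V → Prop
  | root (ρ : Rule S V) (σ : Subst S V) : ρ ∈ R → R.IsConstructorSubst σ →
      Rewrites R (ρ.lhs.toTerm.subst σ) (ρ.rhs.toTerm.subst σ)
  | arg (f : S.Sym) (ts : Fin (S.arity f) → Term S V) (i : Fin (S.arity f)) (t' : Term S V) :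
      Rewrites R (ts i) t' → Rewrites R (Term.app f ts) (Term.app f (Function.update ts i t'))

/-- `𝒱(r) ⊆ 𝒱(ℓ)` for all rules `ℓ → r`. -/
def VariableCondition (R : TRS S V) : Prop := ∀ ρ ∈ R, ∀ x ∈ ρ.rhs.vars, x ∈ ρ.lhs.vars

end TRS

/-! ### Argument filters -/

/-- Every symbol is mapped to a set of its argument positions. -/
def ArgFilter (S : Signature.{u}) := ∀ f : S.Sym, Finset (Fin (S.arity f))

namespace ArgFilter

variable {S : Signature.{u}} {V : Type v}

/-- `π'.IsRefinement π`: `π'` is a refinement of `π`. -/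
def IsRefinement (π' π : ArgFilter S) : Prop := ∀ f, π' f ⊆ π f

/-- The filtered signature `Σ_π`. -/
def sig (π : ArgFilter S) : Signature.{u} where
  Sym := S.Sym
  arity f := (π f).card

/-- `sel f` lists the positions in `π f` in increasing order. -/
def sel (π : ArgFilter S) (f : S.Sym) (i : Fin (π.sig.arity f)) : Fin (S.arity f) :=
  (π f).orderEmbOfFin rfl i

def filterStep (π : ArgFilter S) (t : Term S V) : (termShape π.sig V).Obj (Term S V) :=
  match PFunctor.M.dest t with
  | ⟨Sum.inl x, _⟩ => ⟨Sum.inl x, Fin.elim0⟩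
  | ⟨Sum.inr f, ts⟩ => ⟨Sum.inr f, fun i => ts (π.sel f i)⟩

/-- The filtered term `π(t)`; see `filterTerm_var` and `filterTerm_app`. -/
def filterTerm (π : ArgFilter S) (t : Term S V) : Term π.sig V :=
  PFunctor.M.corec π.filterStep t

@[simp] theorem filterTerm_var (π : ArgFilter S) (x : V) :
    π.filterTerm (Term.var x) = Term.var x := by
  unfold filterTerm
  rw [← PFunctor.M.mk_dest (PFunctor.M.corec _ _), PFunctor.M.dest_corec]
  simp only [filterStep, Term.dest_var]
  exact congrArg (fun g => PFunctor.M.mk (F := termShape π.sig V) ⟨Sum.inl x, g⟩)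
    (funext fun i => Fin.elim0 i)

@[simp] theorem filterTerm_app (π : ArgFilter S) (f : S.Sym)
    (ts : Fin (S.arity f) → Term S V) :
    π.filterTerm (Term.app f ts) =
      Term.app (S := π.sig) f fun i => π.filterTerm (ts (π.sel f i)) := by
  unfold filterTerm
  rw [← PFunctor.M.mk_dest (PFunctor.M.corec _ _), PFunctor.M.dest_corec]
  simp only [filterStep, Term.dest_app]
  rfl

/-- `π(t) ∈ 𝒯(Σ_π)`: the filtered term is finite and ground. -/
def IsFiniteGround (π : ArgFilter S) (t : Term S V) : Prop :=
  (π.filterTerm t).IsFinite ∧ (π.filterTerm t).IsGround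

/-- The filtered atom `π(A)`; the filter `π` on the function symbols and `πD` on the predicate
symbols together form an argument filter over the signature of the program. -/
def filterAtom {D : Signature.{u'}} (π : ArgFilter S) (πD : ArgFilter D)
    (A : Atom D (Term S V)) : Atom πD.sig (Term π.sig V) where
  pred := A.pred
  args i := π.filterTerm (A.args (πD.sel A.pred i))

def filterFin (π : ArgFilter S) : FinTerm S V → FinTerm π.sig V
  | FinTerm.var x => FinTerm.var x
  | FinTerm.app f ts => FinTerm.app (S := π.sig) f fun i => π.filterFin (ts (π.sel f i))

def filterRule (π : ArgFilter S) (ρ : Rule S V) : Rule π.sig V where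
  root := ρ.root
  args i := π.filterFin (ρ.args (π.sel ρ.root i))
  rhs := π.filterFin ρ.rhs

/-- `π(R) = {π(ℓ) → π(r) | ℓ → r ∈ R}`. -/
def filterTRS (π : ArgFilter S) (R : TRS S V) : TRS π.sig V := π.filterRule '' R

end ArgFilter

/-! ### Dependency pairs and chains -/

namespace TRS

variable {S : Signature.{u}} {V : Type v}

/-- The signature extended by a fresh tuple symbol for every defined symbol. -/
def tupleSig (R : TRS S V) : Signature.{u} where
  Sym := S.Sym ⊕ R.definedSyms
  arity := Sum.elim S.arity fun f => S.arity f.1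

def tupleHom (R : TRS S V) : SigHom S R.tupleSig := ⟨Sum.inl, fun _ => rfl⟩

/-- The TRS `R`, regarded as a TRS over the signature extended by tuple symbols. -/
def lift (R : TRS S V) : TRS R.tupleSig V :=
  {ρ' | ∃ ρ ∈ R, ρ' = ⟨Sum.inl ρ.root, fun i => (ρ.args i).mapSym R.tupleHom,
    ρ.rhs.mapSym R.tupleHom⟩}

/-- The term `t♯` for `t = g(ts)` with a defined symbol `g`. -/
def sharp (R : TRS S V) (g : R.definedSyms) (ts : Fin (S.arity g) → FinTerm S V) :
    FinTerm R.tupleSig V :=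
  FinTerm.app (S := R.tupleSig) (Sum.inr g) fun i => (ts i).mapSym R.tupleHom

/-- The dependency pairs `ℓ♯ → t♯` for the rules `ℓ → r` of `R` and the subterms `t` of `r` with
defined root. -/
def DP (R : TRS S V) : TRS R.tupleSig V :=
  {ρ' | ∃ (ρ : Rule S V) (hρ : ρ ∈ R) (g : R.definedSyms) (ts : Fin (S.arity g) → FinTerm S V),
    FinTerm.IsSubterm (FinTerm.app g.1 ts) ρ.rhs ∧
    ρ' = ⟨Sum.inr ⟨ρ.root, ρ, hρ, rfl⟩, fun i => (ρ.args i).mapSym R.tupleHom, R.sharp g ts⟩}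

/-- The infinite sequence `pair 0, pair 1, …` is a `(𝒟, R, π)`-chain. All terms of the rewrite
sequences from `tᵢσᵢ` to `sᵢ₊₁σᵢ₊₁` have to be finite and ground after filtering. -/
def IsInfiniteChain (𝒟 R : TRS S V) (π : ArgFilter S) (pair : ℕ → Rule S V) : Prop :=
  (∀ i, pair i ∈ 𝒟) ∧ ∃ σ : ℕ → Subst S V, (∀ i, R.IsConstructorSubst (σ i)) ∧
    ∀ i, π.IsFiniteGround ((pair i).lhs.toTerm.subst (σ i)) ∧
      π.IsFiniteGround ((pair i).rhs.toTerm.subst (σ i)) ∧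
      Relation.ReflTransGen (fun q q' => R.Rewrites q q' ∧ π.IsFiniteGround q')
        ((pair i).rhs.toTerm.subst (σ i)) ((pair (i + 1)).lhs.toTerm.subst (σ (i + 1)))

end TRS

/-! ### The transformation of logic programs into TRSs -/

section Transformation

variable {S : Signature.{u}} {D : Signature.{u'}} {V : Type v}

open Classical in
/-- The variables of the head and of the first `i` body atoms, each listed once:
`𝒱(s) ∪ 𝒱(s₁) ∪ … ∪ 𝒱(sᵢ)`. -/
noncomputable def Clause.varsUpTo (c : Clause S D V) (i : ℕ) : List V :=
  (c.head.varList ++ ((c.body.take i).map Atom.varList).flatten).dedup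

/-- The symbols of `Σ_P`. The symbol `u c i` is `u_{c,i+1}`. -/
inductive ProgSym (P : LogicProgram S D V) : Type (max u u' v)
  | fn (f : S.Sym) : ProgSym P
  | pin (p : D.Sym) : ProgSym P
  | pout (p : D.Sym) : ProgSym P
  | u (c : P.clauses) (i : Fin c.1.body.length) : ProgSym P

/-- The signature `Σ_P`. -/
noncomputable def LogicProgram.sig (P : LogicProgram S D V) : Signature.{max u u' v} where
  Sym := ProgSym P
  arity
    | ProgSym.fn f => S.arity f
    | ProgSym.pin p => D.arity p
    | ProgSym.pout p => D.arity p
    | ProgSym.u c i => (c.1.varsUpTo i).length + 1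

namespace LogicProgram

variable (P : LogicProgram S D V)

noncomputable def fnHom : SigHom S P.sig := ⟨ProgSym.fn, fun _ => rfl⟩

/-- The arguments of an atom, as terms over `Σ_P`. -/
noncomputable def argTerms (A : Atom D (FinTerm S V)) (i : Fin (D.arity A.pred)) :
    FinTerm P.sig V := (A.args i).mapSym P.fnHom

/-- `p_in(s)` for the atom `p(s)`. -/
noncomputable def inTerm (A : Atom D (FinTerm S V)) : FinTerm P.sig V :=
  FinTerm.app (S := P.sig) (ProgSym.pin A.pred) (P.argTerms A)

/-- `p_out(s)` for the atom `p(s)`. -/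
noncomputable def outTerm (A : Atom D (FinTerm S V)) : FinTerm P.sig V :=
  FinTerm.app (S := P.sig) (ProgSym.pout A.pred) (P.argTerms A)

/-- The arguments `t, 𝒱(s) ∪ 𝒱(s₁) ∪ … ∪ 𝒱(sᵢ)` of `u_{c,i+1}`. -/
noncomputable def uArgs (c : P.clauses) (i : Fin c.1.body.length) (t : FinTerm P.sig V) :
    Fin ((c.1.varsUpTo i).length + 1) → FinTerm P.sig V :=
  Fin.cons t fun j => FinTerm.var ((c.1.varsUpTo i).get j)

noncomputable def uTerm (c : P.clauses) (i : Fin c.1.body.length) (t : FinTerm P.sig V) :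
    FinTerm P.sig V :=
  FinTerm.app (S := P.sig) (ProgSym.u c i) (P.uArgs c i t)

/-- The rules of `R_P`. -/
inductive IsTransformedRule : Rule P.sig V → Prop
  /-- `p_in(s) → p_out(s)` for a fact `p(s)` -/
  | fact (c : P.clauses) (h : c.1.body = []) :
      IsTransformedRule ⟨ProgSym.pin c.1.head.pred, P.argTerms c.1.head, P.outTerm c.1.head⟩
  /-- `p_in(s) → u_{c,1}(p₁_in(s₁), 𝒱(s))` -/
  | first (c : P.clauses) (h : 0 < c.1.body.length) :
      IsTransformedRule ⟨ProgSym.pin c.1.head.pred, P.argTerms c.1.head,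
        P.uTerm c ⟨0, h⟩ (P.inTerm c.1.body[0])⟩
  /-- `u_{c,j}(pⱼ_out(sⱼ), 𝒱(s) ∪ … ∪ 𝒱(sⱼ₋₁)) → u_{c,j+1}(pⱼ₊₁_in(sⱼ₊₁), 𝒱(s) ∪ … ∪ 𝒱(sⱼ))`
  with `j = i + 1` -/
  | next (c : P.clauses) (i : ℕ) (h : i + 1 < c.1.body.length) :
      IsTransformedRule ⟨ProgSym.u c ⟨i, by omega⟩,
        P.uArgs c ⟨i, by omega⟩ (P.outTerm c.1.body[i]),
        P.uTerm c ⟨i + 1, h⟩ (P.inTerm c.1.body[i + 1])⟩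
  /-- `u_{c,k}(pₖ_out(sₖ), 𝒱(s) ∪ … ∪ 𝒱(sₖ₋₁)) → p_out(s)` with `k = i + 1` -/
  | last (c : P.clauses) (i : ℕ) (h : i + 1 = c.1.body.length) :
      IsTransformedRule ⟨ProgSym.u c ⟨i, by omega⟩,
        P.uArgs c ⟨i, by omega⟩ (P.outTerm c.1.body[i]), P.outTerm c.1.head⟩

/-- The TRS `R_P`. -/
def trs : TRS P.sig V := {ρ | P.IsTransformedRule ρ}

/-- The extension of an argument filter over the signature of the program to `Σ_P` and the tuple
symbols: `π(p_in) = π(P_in) = π(p)`, and nothing is filtered away from the other new symbols. -/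
noncomputable def extendFilter (π : ArgFilter S) (πD : ArgFilter D) : ArgFilter P.trs.tupleSig
  | Sum.inl (ProgSym.fn f) => π f
  | Sum.inl (ProgSym.pin p) => πD p
  | Sum.inr ⟨ProgSym.pin p, _⟩ => πD p
  | _ => Finset.univ

end LogicProgram

end Transformation

end LPTermination

open LPTermination

/-!
Every infinite derivation from `Q` is turned into an infinite chain, in three steps.

*Passing to a single instance.* A derivation `q₀ ⊢ q₁ ⊢ …` with unifiers `θ₀, θ₁, …` keeps
instantiating its terms. Over possibly infinite terms, the infinite composition
`σᵢ = θᵢ θᵢ₊₁ θᵢ₊₂ ⋯` exists: it is a substitution (`Subst.limit`) with `σᵢ = θᵢ σᵢ₊₁`. Hence the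
sequence of the `qᵢ σᵢ` is an infinite derivation in which nothing is instantiated any more: every
step replaces an instance `Hτ` of a clause head by the same instance of the clause body
(`LogicProgram.InstStep`, `LogicProgram.instStep_of_isResolvent`).

*From instances to rewriting.* If `A` is the root of a successful derivation of this kind, then
`A_in` rewrites to `A_out` (`LogicProgram.Succeeds.rewrites`). If a query `A, As` does not
terminate, then either `A` alone does not, or `A` succeeds and `As` does not terminate
(`LogicProgram.not_instTerminates_cons`). Consequently, for a non-terminating atom `A` there is a
clause with `A = Hτ` and a body atom `Bⱼτ` (counted from `0`) that does not terminate, while the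
body atoms before it succeed. The dependency pairs of the rules for `u_{c,1}, …, u_{c,j}` lead from
`A_in♯` to `(Bⱼτ)_in♯`, and this can be repeated for ever (`LogicProgram.Live.exists_pair`).

*The filter.* Whether `π(t)` is finite and ground depends only on the positions that `π` keeps, which
gives the inductive description `ArgFilter.FiltersToGround`. By the variable condition this property
is preserved by all rewrite steps and dependency pairs, so that it holds all along the chain once it
holds for its first term `(Qσ₀)_in♯`. There it is inherited from `π(Q)`, as `π'` refines `π`.
-/

namespace LPTermination

universe u u' v

/-! ### Possibly infinite terms -/

namespace Term

variable {S : Signature.{u}} {V : Type v}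

theorem var_ne_app {x : V} {f : S.Sym} {ts : Fin (S.arity f) → Term S V} :
    (var x : Term S V) ≠ app f ts := by
  intro h
  have h' := congrArg PFunctor.M.dest h
  rw [dest_var, dest_app] at h'
  exact Sum.inl_ne_inr (congrArg Sigma.fst h')

theorem var_injective {x y : V} (h : (var x : Term S V) = var y) : x = y := by
  have h' := congrArg PFunctor.M.dest h
  rw [dest_var, dest_var] at h'
  exact Sum.inl_injective (congrArg Sigma.fst h')

theorem sym_eq_of_app_eq {f g : S.Sym} {ts : Fin (S.arity f) → Term S V}
    {us : Fin (S.arity g) → Term S V} (h : app f ts = app g us) : f = g := by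
  have h' := congrArg PFunctor.M.dest h
  rw [dest_app, dest_app] at h'
  exact Sum.inr_injective (congrArg Sigma.fst h')

theorem args_eq_of_app_eq {f : S.Sym} {ts us : Fin (S.arity f) → Term S V}
    (h : app f ts = app f us) : ts = us := by
  have h' := congrArg PFunctor.M.dest h
  rw [dest_app, dest_app] at h'
  exact eq_of_heq (Sigma.mk.inj h').2

theorem IsSubterm.of_app {s : Term S V} {f : S.Sym} {ts : Fin (S.arity f) → Term S V}
    (h : IsSubterm s (app f ts)) : s = app f ts ∨ ∃ i, IsSubterm s (ts i) := by
  generalize ht : app f ts = t at h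
  cases h with
  | refl => exact Or.inl rfl
  | arg g us i hi =>
    obtain rfl := sym_eq_of_app_eq ht
    obtain rfl := args_eq_of_app_eq ht
    exact Or.inr ⟨i, hi⟩

/-- Coinduction: terms related by a bisimulation are equal. -/
theorem eq_of_bisim (R : Term S V → Term S V → Prop)
    (hR : ∀ a b, R a b → a = b ∨ ∃ f ts us, a = app f ts ∧ b = app f us ∧ ∀ i, R (ts i) (us i))
    {a b : Term S V} (h : R a b) : a = b := by
  refine PFunctor.M.bisim (P := termShape S V) (fun a b => a = b ∨ R a b) ?_ a b (Or.inr h)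
  intro a b hab
  have hab' : a = b ∨ ∃ f ts us, a = app f ts ∧ b = app f us ∧ ∀ i, R (ts i) (us i) :=
    hab.elim Or.inl (hR a b)
  rcases hab' with rfl | ⟨f, ts, us, rfl, rfl, h⟩
  · exact ⟨(PFunctor.M.dest a).1, (PFunctor.M.dest a).2, (PFunctor.M.dest a).2, rfl, rfl,
      fun i => Or.inl rfl⟩
  · exact ⟨Sum.inr f, ts, us, dest_app f ts, dest_app f us, fun i => Or.inr (h i)⟩

theorem subst_comp (θ μ : Subst S V) (t : Term S V) :
    t.subst (θ.comp μ) = (t.subst θ).subst μ := by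
  refine eq_of_bisim (fun a b => ∃ t : Term S V, a = t.subst (θ.comp μ) ∧
    b = (t.subst θ).subst μ) ?_ ⟨t, rfl, rfl⟩
  rintro _ _ ⟨t, rfl, rfl⟩
  rcases t.exists_rep with ⟨x, rfl⟩ | ⟨f, ts, rfl⟩
  · left
    rw [subst_var, subst_var]
    rfl
  · right
    exact ⟨f, _, _, subst_app _ _ _, by rw [subst_app, subst_app], fun i => ⟨ts i, rfl, rfl⟩⟩

/-- One step of the corecursive definition of `mapSym`. -/
def mapSymStep {S' : Signature.{u'}} (φ : SigHom S S') (t : Term S V) :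
    (termShape S' V).Obj (Term S V) :=
  match PFunctor.M.dest t with
  | ⟨Sum.inl x, _⟩ => ⟨Sum.inl x, Fin.elim0⟩
  | ⟨Sum.inr f, ts⟩ => ⟨Sum.inr (φ.toFun f), fun i => ts (Fin.cast (φ.arity_eq f) i)⟩

/-- The same possibly infinite term, regarded as a term over a larger signature. -/
def mapSym {S' : Signature.{u'}} (φ : SigHom S S') (t : Term S V) : Term S' V :=
  PFunctor.M.corec (mapSymStep φ) t

theorem mapSym_var {S' : Signature.{u'}} (φ : SigHom S S') (x : V) :
    (var x : Term S V).mapSym φ = var x := by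
  unfold mapSym
  rw [← PFunctor.M.mk_dest (PFunctor.M.corec _ _), PFunctor.M.dest_corec]
  simp only [mapSymStep, dest_var]
  exact congrArg (fun g => PFunctor.M.mk (F := termShape S' V) ⟨Sum.inl x, g⟩)
    (funext fun i => Fin.elim0 i)

theorem mapSym_app {S' : Signature.{u'}} (φ : SigHom S S') (f : S.Sym)
    (ts : Fin (S.arity f) → Term S V) :
    (app f ts).mapSym φ = app (φ.toFun f) fun i => (ts (Fin.cast (φ.arity_eq f) i)).mapSym φ := by
  unfold mapSym
  rw [← PFunctor.M.mk_dest (PFunctor.M.corec _ _), PFunctor.M.dest_corec]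
  simp only [mapSymStep, dest_app]
  rfl

theorem IsSubterm.exists_of_mapSym {S' : Signature.{u'}} {φ : SigHom S S'} {s : Term S' V}
    {t : Term S V} (h : IsSubterm s (t.mapSym φ)) : ∃ t₀, IsSubterm t₀ t ∧ s = t₀.mapSym φ := by
  generalize ht : t.mapSym φ = t' at h
  induction h generalizing t with
  | refl => exact ⟨t, .refl, ht.symm⟩
  | arg f ts i _ ih =>
    rcases t.exists_rep with ⟨x, rfl⟩ | ⟨g, us, rfl⟩
    · rw [mapSym_var] at ht
      exact absurd ht var_ne_app
    · rw [mapSym_app] at ht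
      obtain rfl := sym_eq_of_app_eq ht
      obtain rfl := args_eq_of_app_eq ht
      obtain ⟨t₀, h₀, hs⟩ := ih rfl
      exact ⟨t₀, .arg g us _ h₀, hs⟩

theorem syms_mapSym_subset {S' : Signature.{u'}} (φ : SigHom S S') (t : Term S V) :
    (t.mapSym φ).syms ⊆ φ.toFun '' t.syms := by
  rintro f ⟨ts, h⟩
  obtain ⟨t₀, hsub, h₀⟩ := h.exists_of_mapSym
  rcases t₀.exists_rep with ⟨x, rfl⟩ | ⟨g, us, rfl⟩
  · rw [mapSym_var] at h₀
    exact absurd h₀.symm var_ne_app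
  · rw [mapSym_app] at h₀
    exact ⟨g, ⟨us, hsub⟩, (sym_eq_of_app_eq h₀).symm⟩

end Term

namespace FinTerm

variable {S : Signature.{u}} {V : Type v}

theorem toTerm_subst_mapSym {S' : Signature.{u'}} (φ : SigHom S S') (τ : Subst S V)
    (s : FinTerm S V) :
    (s.toTerm.subst τ).mapSym φ = (s.mapSym φ).toTerm.subst fun x => (τ x).mapSym φ := by
  induction s with
  | var x => simp only [toTerm, mapSym, Term.subst_var]
  | app f ts ih =>
    simp only [toTerm, mapSym, Term.subst_app, Term.mapSym_app]
    exact congrArg (Term.app _) (funext fun i => ih _)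

theorem toTerm_rename_subst (e : V → V) (σ : Subst S V) (s : FinTerm S V) :
    (s.rename e).toTerm.subst σ = s.toTerm.subst fun x => σ (e x) := by
  induction s with
  | var x => simp only [toTerm, rename, Term.subst_var]
  | app f ts ih =>
    simp only [toTerm, rename, Term.subst_app]
    exact congrArg (Term.app _) (funext ih)

end FinTerm

/-! ### Infinite compositions of substitutions -/

namespace Subst

variable {S : Signature.{u}} {V : Type v}

/-- `EventualNode θ i t o`: the root of `t θᵢ θᵢ₊₁ ⋯` is known after finitely many of the
substitutions. It is the node `o`, whose children `(k, s)` stand for `s θₖ θₖ₊₁ ⋯`. -/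
inductive EventualNode (θ : ℕ → Subst S V) :
    ℕ → Term S V → (termShape S V).Obj (ℕ × Term S V) → Prop
  | app (i : ℕ) (f : S.Sym) (ts : Fin (S.arity f) → Term S V) :
      EventualNode θ i (Term.app f ts) ⟨Sum.inr f, fun j => (i, ts j)⟩
  | var (i : ℕ) (x : V) (o : (termShape S V).Obj (ℕ × Term S V)) :
      EventualNode θ (i + 1) (θ i x) o → EventualNode θ i (Term.var x) o

theorem eventualNode_app_iff {θ : ℕ → Subst S V} {i : ℕ} {f : S.Sym}
    {ts : Fin (S.arity f) → Term S V} {o : (termShape S V).Obj (ℕ × Term S V)} :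
    EventualNode θ i (Term.app f ts) o ↔ o = ⟨Sum.inr f, fun j => (i, ts j)⟩ := by
  refine ⟨fun h => ?_, ?_⟩
  · generalize ht : Term.app f ts = t at h
    cases h with
    | app _ g us =>
      obtain rfl := Term.sym_eq_of_app_eq ht
      obtain rfl := Term.args_eq_of_app_eq ht
      rfl
    | var _ x _ _ => exact absurd ht.symm Term.var_ne_app
  · rintro rfl
    exact .app i f ts

theorem eventualNode_var_iff {θ : ℕ → Subst S V} {i : ℕ} {x : V}
    {o : (termShape S V).Obj (ℕ × Term S V)} :
    EventualNode θ i (Term.var x) o ↔ EventualNode θ (i + 1) (θ i x) o := by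
  refine ⟨fun h => ?_, .var i x o⟩
  generalize ht : (Term.var x : Term S V) = t at h
  cases h with
  | app _ g us => exact absurd ht Term.var_ne_app
  | var _ y _ h =>
    obtain rfl := Term.var_injective ht
    exact h

variable [Nonempty V]

theorem nonempty_node (X : Type*) : Nonempty ((termShape S V).Obj X) :=
  ‹Nonempty V›.map fun x => ⟨Sum.inl x, Fin.elim0⟩

/-- The root of `t θᵢ θᵢ₊₁ ⋯`. If it stays a variable for ever, then `Classical.epsilon` picks some
node that depends only on the (empty) predicate `EventualNode θ i t`; any choice is as good. -/
noncomputable def limitStep (θ : ℕ → Subst S V) (p : ℕ × Term S V) :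
    (termShape S V).Obj (ℕ × Term S V) :=
  @Classical.epsilon _ (nonempty_node _) (EventualNode θ p.1 p.2)

/-- The term `t θᵢ θᵢ₊₁ ⋯` for the pair `(i, t)`. -/
noncomputable def limitTerm (θ : ℕ → Subst S V) (p : ℕ × Term S V) : Term S V :=
  PFunctor.M.corec (limitStep θ) p

/-- The infinite composition `θᵢ θᵢ₊₁ ⋯`; see `limit_eq_comp`. -/
noncomputable def limit (θ : ℕ → Subst S V) (i : ℕ) : Subst S V :=
  fun x => limitTerm θ (i, Term.var x)

theorem limitTerm_app (θ : ℕ → Subst S V) (i : ℕ) (f : S.Sym) (ts : Fin (S.arity f) → Term S V) :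
    limitTerm θ (i, Term.app f ts) = Term.app f fun j => limitTerm θ (i, ts j) := by
  have h : limitStep θ (i, Term.app f ts) = ⟨Sum.inr f, fun j => (i, ts j)⟩ :=
    eventualNode_app_iff.1 (Classical.epsilon_spec_aux (nonempty_node _)
      (EventualNode θ i (Term.app f ts)) ⟨_, .app i f ts⟩)
  unfold limitTerm
  rw [← PFunctor.M.mk_dest (PFunctor.M.corec _ _), PFunctor.M.dest_corec, h]
  rfl

theorem limitTerm_var (θ : ℕ → Subst S V) (i : ℕ) (x : V) :
    limitTerm θ (i, Term.var x) = limitTerm θ (i + 1, θ i x) := by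
  have h : limitStep θ (i, Term.var x) = limitStep θ (i + 1, θ i x) :=
    congrArg (@Classical.epsilon _ (nonempty_node _))
      (funext fun _ => propext eventualNode_var_iff)
  unfold limitTerm
  rw [← PFunctor.M.mk_dest (PFunctor.M.corec (limitStep θ) (i, Term.var x)),
    PFunctor.M.dest_corec, h, ← PFunctor.M.dest_corec, PFunctor.M.mk_dest]

theorem limitTerm_eq_subst (θ : ℕ → Subst S V) (i : ℕ) (t : Term S V) :
    limitTerm θ (i, t) = t.subst (limit θ i) := by
  refine Term.eq_of_bisim (fun a b => ∃ t : Term S V, a = limitTerm θ (i, t) ∧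
    b = t.subst (limit θ i)) ?_ ⟨t, rfl, rfl⟩
  rintro _ _ ⟨t, rfl, rfl⟩
  rcases t.exists_rep with ⟨x, rfl⟩ | ⟨f, ts, rfl⟩
  · left
    rw [Term.subst_var]
    rfl
  · right
    exact ⟨f, _, _, limitTerm_app θ i f ts, Term.subst_app _ _ _, fun j => ⟨ts j, rfl, rfl⟩⟩

theorem limit_eq_comp (θ : ℕ → Subst S V) (i : ℕ) : limit θ i = (θ i).comp (limit θ (i + 1)) :=
  funext fun x => (limitTerm_var θ i x).trans (limitTerm_eq_subst θ (i + 1) (θ i x))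

end Subst

/-! ### Derivations without instantiation -/

namespace Atom

variable {S : Signature.{u}} {D : Signature.{u'}} {V : Type v}

theorem subst_comp (θ μ : Subst S V) (A : Atom D (Term S V)) :
    A.subst (θ.comp μ) = (A.subst θ).subst μ :=
  congrArg (Atom.mk A.pred) (funext fun i => Term.subst_comp θ μ (A.args i))

theorem toInf_rename_subst (e : V → V) (σ : Subst S V) (A : Atom D (FinTerm S V)) :
    (A.map (FinTerm.rename e)).toInf.subst σ = A.toInf.subst fun x => σ (e x) :=
  congrArg (Atom.mk A.pred) (funext fun i => FinTerm.toTerm_rename_subst e σ (A.args i))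

end Atom

namespace LogicProgram

variable {S : Signature.{u}} {D : Signature.{u'}} {V : Type v} (P : LogicProgram S D V)

/-- Resolution without unification: the first atom is an instance of a clause head and is replaced
by the same instance of the clause body. -/
inductive InstStep : Query S D V → Query S D V → Prop
  | intro (c : P.clauses) (τ : Subst S V) (As : Query S D V) :
      InstStep (c.1.head.toInf.subst τ :: As) (c.1.body.map (fun B => B.toInf.subst τ) ++ As)

/-- `A` is the root of a finite proof tree whose nodes are instances of clauses. -/
inductive Succeeds : Atom D (Term S V) → Prop
  | intro (c : P.clauses) (τ : Subst S V) :
      (∀ B ∈ c.1.body, Succeeds (B.toInf.subst τ)) → Succeeds (c.1.head.toInf.subst τ)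

/-- There is no infinite sequence of steps `InstStep` from `G`. -/
abbrev InstTerminates (G : Query S D V) : Prop := Acc (fun G' G => P.InstStep G G') G

variable {P}

/-- Non-termination of `G, As` comes from `G` itself, or from `As` after `G` has succeeded. -/
theorem InstTerminates.append {G As : Query S D V} (hG : P.InstTerminates G)
    (hAs : (∀ A ∈ G, P.Succeeds A) → P.InstTerminates As) : P.InstTerminates (G ++ As) := by
  induction hG with
  | intro G _ ih =>
    cases G with
    | nil => exact hAs (by simp)
    | cons A G =>
      refine Acc.intro _ fun G' hG' => ?_
      rw [List.cons_append] at hG'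
      generalize hH : A :: (G ++ As) = H at hG'
      cases hG' with
      | intro c τ Bs =>
        obtain ⟨rfl, rfl⟩ := List.cons.inj hH
        rw [← List.append_assoc]
        refine ih _ (.intro c τ G) fun hs => hAs ?_
        simp only [List.mem_append, List.mem_map] at hs
        intro A hA
        rcases List.mem_cons.1 hA with rfl | hA
        · exact .intro c τ fun B hB => hs _ (Or.inl ⟨B, hB, rfl⟩)
        · exact hs A (Or.inr hA)

theorem not_instTerminates_cons {A : Atom D (Term S V)} {As : Query S D V}
    (h : ¬ P.InstTerminates (A :: As)) :
    ¬ P.InstTerminates [A] ∨ P.Succeeds A ∧ ¬ P.InstTerminates As := by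
  by_contra! hc
  refine h (InstTerminates.append (G := [A]) hc.1 fun hs => ?_)
  exact hc.2 (hs A (by simp))

theorem instTerminates_nil : P.InstTerminates [] :=
  Acc.intro _ fun _ h => nomatch h

theorem exists_clause_of_not_instTerminates {A : Atom D (Term S V)}
    (h : ¬ P.InstTerminates [A]) : ∃ (c : P.clauses) (τ : Subst S V),
      A = c.1.head.toInf.subst τ ∧ ¬ P.InstTerminates (c.1.body.map fun B => B.toInf.subst τ) := by
  by_contra! hc
  refine h (Acc.intro _ fun G' hG' => ?_)
  generalize hH : [A] = H at hG'
  cases hG' with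
  | intro c τ As =>
    obtain ⟨rfl, rfl⟩ := List.cons.inj hH
    rw [List.append_nil]
    exact hc c τ rfl

theorem not_instTerminates_of_seq {g : ℕ → Query S D V}
    (hg : ∀ i, P.InstStep (g i) (g (i + 1))) (i : ℕ) : ¬ P.InstTerminates (g i) := by
  intro h
  generalize hG : g i = G at h
  induction h generalizing i with
  | intro G _ ih => exact ih (g (i + 1)) (hG ▸ hg i) (i + 1) rfl

/-- A resolution step whose unifier `θ` is absorbed by `σ = θμ`. The variant of the clause, renamed
by `e` and then instantiated by `σ`, is the instance of the clause itself by `x ↦ σ (e x)`. -/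
theorem instStep_of_isResolvent {c : Clause S D V} (hc : c ∈ P.clauses) {e : Equiv.Perm V}
    {θ μ : Subst S V} {q q' : Query S D V} (h : IsResolvent q (c.rename e) θ q') :
    P.InstStep (q.map (Atom.subst (θ.comp μ))) (q'.map (Atom.subst μ)) := by
  obtain ⟨A, As, rfl, ⟨hθ, -⟩, rfl⟩ := h
  have hA : A.subst (θ.comp μ) = c.head.toInf.subst fun x => θ.comp μ (e x) := by
    rw [Atom.subst_comp, show A.subst θ = _ from hθ, ← Atom.subst_comp]
    exact Atom.toInf_rename_subst e _ c.head
  have hB : ((((c.rename e).body.map Atom.toInf ++ As).map (Atom.subst θ)).map (Atom.subst μ)) =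
      c.body.map (fun B => B.toInf.subst fun x => θ.comp μ (e x)) ++
        As.map (Atom.subst (θ.comp μ)) := by
    simp only [Clause.rename, List.map_append, List.map_map]
    congr 1
    · refine List.map_congr_left fun B _ => ?_
      exact (Atom.subst_comp θ μ _).symm.trans (Atom.toInf_rename_subst e _ B)
    · exact List.map_congr_left fun B _ => (Atom.subst_comp θ μ B).symm
  rw [hB, List.map_cons, hA]
  exact .intro ⟨c, hc⟩ _ _

theorem exists_not_instTerminates [Nonempty V] {Q : Query S D V} (h : ¬ P.Terminates Q) :
    ∃ σ : Subst S V, ¬ P.InstTerminates (Q.map (Atom.subst σ)) := by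
  obtain ⟨q, rfl, hq⟩ := not_not.1 h
  choose c hc e _ θ hθ using hq
  refine ⟨Subst.limit θ 0, not_instTerminates_of_seq
    (g := fun i => (q i).map (Atom.subst (Subst.limit θ i))) (fun i => ?_) 0⟩
  show P.InstStep ((q i).map (Atom.subst (Subst.limit θ i))) _
  rw [Subst.limit_eq_comp]
  exact instStep_of_isResolvent (hc i) (hθ i)

end LogicProgram

/-! ### Terms that become finite and ground by filtering -/

namespace ArgFilter

variable {S : Signature.{u}} {V : Type v}

/-- An inductive description of `IsFiniteGround`; see `isFiniteGround_iff`. -/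
inductive FiltersToGround (π : ArgFilter S) : Term S V → Prop
  | app (f : S.Sym) (ts : Fin (S.arity f) → Term S V) :
      (∀ i ∈ π f, FiltersToGround π (ts i)) → FiltersToGround π (Term.app f ts)

theorem filtersToGround_app_iff {π : ArgFilter S} {f : S.Sym}
    {ts : Fin (S.arity f) → Term S V} :
    π.FiltersToGround (Term.app f ts) ↔ ∀ i ∈ π f, π.FiltersToGround (ts i) := by
  refine ⟨fun h => ?_, .app f ts⟩
  generalize ht : Term.app f ts = t at h
  cases h with
  | app g us h =>
    obtain rfl := Term.sym_eq_of_app_eq ht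
    obtain rfl := Term.args_eq_of_app_eq ht
    exact h

theorem sel_mem (π : ArgFilter S) (f : S.Sym) (i : Fin (π.sig.arity f)) : π.sel f i ∈ π f :=
  Finset.orderEmbOfFin_mem _ _ _

theorem exists_sel_eq {π : ArgFilter S} {f : S.Sym} {i : Fin (S.arity f)} (h : i ∈ π f) :
    ∃ j, π.sel f j = i := by
  have h' : i ∈ Set.range ((π f).orderEmbOfFin rfl) := by
    rw [Finset.range_orderEmbOfFin]
    exact h
  exact h'

theorem isFiniteGround_iff {π : ArgFilter S} {t : Term S V} :
    π.IsFiniteGround t ↔ π.FiltersToGround t := by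
  constructor
  · rintro ⟨hfin, hground⟩
    generalize ht : π.filterTerm t = s at hfin hground
    induction hfin generalizing t with
    | var x =>
      have hx : x ∈ (Term.var x : Term π.sig V).vars := Term.IsSubterm.refl
      rw [show (Term.var x : Term π.sig V).vars = ∅ from hground] at hx
      exact hx.elim
    | app f ts _ ih =>
      rcases t.exists_rep with ⟨x, rfl⟩ | ⟨g, us, rfl⟩
      · rw [filterTerm_var] at ht
        exact absurd ht Term.var_ne_app
      · rw [filterTerm_app] at ht
        obtain rfl := Term.sym_eq_of_app_eq ht
        obtain rfl := Term.args_eq_of_app_eq ht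
        refine .app _ _ fun i hi => ?_
        obtain ⟨j, rfl⟩ := exists_sel_eq hi
        refine ih j rfl (Set.eq_empty_of_forall_notMem fun x hx => ?_)
        exact Set.eq_empty_iff_forall_notMem.1 hground x
          (.arg (S := π.sig) _ (fun j => π.filterTerm (us (π.sel _ j))) j hx)
  · intro h
    induction h with
    | app f ts _ ih =>
      unfold IsFiniteGround
      rw [filterTerm_app]
      refine ⟨.app _ _ fun i => (ih _ (π.sel_mem f i)).1,
        Set.eq_empty_of_forall_notMem fun x hx => ?_⟩
      rcases Term.IsSubterm.of_app hx with h | ⟨i, hi⟩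
      · exact Term.var_ne_app h
      · exact Set.eq_empty_iff_forall_notMem.1 (ih _ (π.sel_mem f i)).2 x hi

theorem filtersToGround_subst_iff {π : ArgFilter S} {σ : Subst S V} {s : FinTerm S V} :
    π.FiltersToGround (s.toTerm.subst σ) ↔
      ∀ x ∈ (π.filterFin s).vars, π.FiltersToGround (σ x) := by
  induction s with
  | var x => simp [FinTerm.toTerm, filterFin, FinTerm.vars]
  | app f ts ih =>
    simp only [FinTerm.toTerm, Term.subst_app, filtersToGround_app_iff, ih, filterFin,
      FinTerm.vars, List.mem_flatten, List.mem_ofFn]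
    constructor
    · rintro h x ⟨_, ⟨i, rfl⟩, hx⟩
      exact h _ (π.sel_mem f i) x hx
    · intro h i hi x hx
      obtain ⟨j, rfl⟩ := exists_sel_eq hi
      exact h x ⟨_, ⟨j, rfl⟩, hx⟩

theorem FiltersToGround.rhs {π : ArgFilter S} {R : TRS S V}
    (hR : (π.filterTRS R).VariableCondition) {ρ : Rule S V} (hρ : ρ ∈ R) {σ : Subst S V}
    (h : π.FiltersToGround (ρ.lhs.toTerm.subst σ)) :
    π.FiltersToGround (ρ.rhs.toTerm.subst σ) :=
  filtersToGround_subst_iff.2 fun x hx =>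
    filtersToGround_subst_iff.1 h x (hR _ ⟨ρ, hρ, rfl⟩ x hx)

theorem FiltersToGround.rewrites {π : ArgFilter S} {R : TRS S V}
    (hR : (π.filterTRS R).VariableCondition) {s t : Term S V} (hst : R.Rewrites s t)
    (h : π.FiltersToGround s) : π.FiltersToGround t := by
  induction hst with
  | root ρ σ hρ _ => exact h.rhs hR hρ
  | arg f ts i t' _ ih =>
    rw [filtersToGround_app_iff] at h ⊢
    intro j hj
    by_cases hij : j = i
    · subst hij
      rw [Function.update_self]
      exact ih (h j hj)
    · rw [Function.update_of_ne hij]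
      exact h j hj

theorem FiltersToGround.reflTransGen {π : ArgFilter S} {R : TRS S V}
    (hR : (π.filterTRS R).VariableCondition) {s t : Term S V}
    (hst : Relation.ReflTransGen R.Rewrites s t) (h : π.FiltersToGround s) :
    π.FiltersToGround t ∧
      Relation.ReflTransGen (fun q q' => R.Rewrites q q' ∧ π.IsFiniteGround q') s t := by
  induction hst with
  | refl => exact ⟨h, .refl⟩
  | tail _ hbc ih =>
    have hc := ih.1.rewrites hR hbc
    exact ⟨hc, ih.2.tail ⟨hbc, isFiniteGround_iff.2 hc⟩⟩

end ArgFilter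

/-! ### Rewriting with the transformed program -/

theorem TRS.reflTransGen_rewrites_arg {S : Signature.{u}} {V : Type v} {R : TRS S V} {f : S.Sym}
    {ts us : Fin (S.arity f) → Term S V} {i : Fin (S.arity f)} {s t : Term S V}
    (h : Relation.ReflTransGen R.Rewrites s t) (hts : ts i = s) (hus : us = Function.update ts i t) :
    Relation.ReflTransGen R.Rewrites (Term.app f ts) (Term.app f us) := by
  subst hts hus
  induction h with
  | refl => rw [Function.update_eq_self]
  | @tail b c _ hbc ih =>
    refine ih.tail ?_
    have h := TRS.Rewrites.arg f (Function.update ts i b) i c (by rwa [Function.update_self])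
    rwa [Function.update_idem] at h

namespace LogicProgram

variable {S : Signature.{u}} {D : Signature.{u'}} {V : Type v} (P : LogicProgram S D V)

/-- A term over `S`, regarded as a term over `Σ_P` with tuple symbols. -/
noncomputable def embed (t : Term S V) : Term P.trs.tupleSig V :=
  (t.mapSym P.fnHom).mapSym P.trs.tupleHom

/-- The instance `sτ` of a finite term `s` over `Σ_P`. -/
noncomputable def inst (τ : Subst S V) (s : FinTerm P.sig V) : Term P.trs.tupleSig V :=
  (s.mapSym P.trs.tupleHom).toTerm.subst fun x => P.embed (τ x)

/-- `A_in` -/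
noncomputable def inInst (A : Atom D (Term S V)) : Term P.trs.tupleSig V :=
  Term.app (S := P.trs.tupleSig) (Sum.inl (ProgSym.pin A.pred)) fun i => P.embed (A.args i)

/-- `A_out` -/
noncomputable def outInst (A : Atom D (Term S V)) : Term P.trs.tupleSig V :=
  Term.app (S := P.trs.tupleSig) (Sum.inl (ProgSym.pout A.pred)) fun i => P.embed (A.args i)

/-- `A_in♯` -/
noncomputable def inSharpInst (A : Atom D (Term S V))
    (h : (ProgSym.pin A.pred : ProgSym P) ∈ P.trs.definedSyms) : Term P.trs.tupleSig V :=
  Term.app (S := P.trs.tupleSig) (Sum.inr ⟨ProgSym.pin A.pred, h⟩) fun i => P.embed (A.args i)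

variable {P}

theorem embed_app (f : S.Sym) (ts : Fin (S.arity f) → Term S V) :
    P.embed (Term.app f ts) =
      Term.app (S := P.trs.tupleSig) (Sum.inl (ProgSym.fn f)) fun i => P.embed (ts i) := by
  unfold embed
  rw [Term.mapSym_app, Term.mapSym_app]
  rfl

theorem embed_toTerm_subst (τ : Subst S V) (s : FinTerm S V) :
    P.embed (s.toTerm.subst τ) = P.inst τ (s.mapSym P.fnHom) := by
  unfold embed inst
  rw [FinTerm.toTerm_subst_mapSym, FinTerm.toTerm_subst_mapSym]
  rfl

theorem inst_app (τ : Subst S V) (f : ProgSym P) (ts : Fin (P.sig.arity f) → FinTerm P.sig V) :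
    P.inst τ (FinTerm.app (S := P.sig) f ts) =
      Term.app (S := P.trs.tupleSig) (Sum.inl f) fun i => P.inst τ (ts i) :=
  Term.subst_app _ _ _

theorem sharp_toTerm_subst (τ : Subst S V) (g : P.trs.definedSyms)
    (ts : Fin (P.sig.arity g.1) → FinTerm P.sig V) :
    ((P.trs.sharp g ts).toTerm.subst fun x => P.embed (τ x)) =
      Term.app (S := P.trs.tupleSig) (Sum.inr g) fun i => P.inst τ (ts i) :=
  Term.subst_app _ _ _

theorem inst_argTerms (τ : Subst S V) (A : Atom D (FinTerm S V)) :
    (fun i => P.inst τ (P.argTerms A i)) = fun i => P.embed ((A.toInf.subst τ).args i) :=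
  funext fun i => (embed_toTerm_subst τ (A.args i)).symm

theorem sharp_argTerms_subst (τ : Subst S V) (A : Atom D (FinTerm S V))
    (h : (ProgSym.pin A.pred : ProgSym P) ∈ P.trs.definedSyms) :
    ((P.trs.sharp ⟨ProgSym.pin A.pred, h⟩ (P.argTerms A)).toTerm.subst fun x => P.embed (τ x)) =
      P.inSharpInst (A.toInf.subst τ) h :=
  (sharp_toTerm_subst τ _ _).trans
    (congrArg (Term.app (S := P.trs.tupleSig) _) (inst_argTerms τ A))

theorem inst_inTerm (τ : Subst S V) (A : Atom D (FinTerm S V)) :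
    P.inst τ (P.inTerm A) = P.inInst (A.toInf.subst τ) :=
  (inst_app τ _ _).trans (congrArg (Term.app (S := P.trs.tupleSig) _) (inst_argTerms τ A))

theorem inst_outTerm (τ : Subst S V) (A : Atom D (FinTerm S V)) :
    P.inst τ (P.outTerm A) = P.outInst (A.toInf.subst τ) :=
  (inst_app τ _ _).trans (congrArg (Term.app (S := P.trs.tupleSig) _) (inst_argTerms τ A))

theorem inst_uTerm (τ : Subst S V) (c : P.clauses) (i : Fin c.1.body.length)
    (t : FinTerm P.sig V) : P.inst τ (P.uTerm c i t) =
      Term.app (S := P.trs.tupleSig) (Sum.inl (ProgSym.u c i))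
        fun j => P.inst τ (P.uArgs c i t j) :=
  inst_app τ _ _

theorem inst_uArgs_eq_update (τ : Subst S V) (c : P.clauses) (i : Fin c.1.body.length)
    (t t' : FinTerm P.sig V) :
    (fun j => P.inst τ (P.uArgs c i t' j)) =
      Function.update (fun j => P.inst τ (P.uArgs c i t j)) 0 (P.inst τ t') := by
  funext j
  refine Fin.cases ?_ (fun j => ?_) j
  · rw [Function.update_self]
    rfl
  · rw [Function.update_of_ne (Fin.succ_ne_zero j)]
    rfl

theorem fn_notMem_definedSyms (f : S.Sym) :
    (Sum.inl (ProgSym.fn f) : P.trs.tupleSig.Sym) ∉ P.trs.lift.definedSyms := by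
  rintro ⟨_, ⟨ρ, hρ, rfl⟩, h⟩
  have h' : ρ.root = ProgSym.fn f := Sum.inl_injective h
  cases hρ <;> exact nomatch h'

theorem isConstructorSubst_embed (τ : Subst S V) :
    P.trs.lift.IsConstructorSubst fun x => P.embed (τ x) := by
  intro x g hg
  obtain ⟨_, hg', rfl⟩ := Term.syms_mapSym_subset _ _ hg
  obtain ⟨f, _, rfl⟩ := Term.syms_mapSym_subset _ _ hg'
  exact fn_notMem_definedSyms f

theorem rewrites_inst {ρ : Rule P.sig V} (hρ : ρ ∈ P.trs) (τ : Subst S V) :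
    P.trs.lift.Rewrites (P.inst τ ρ.lhs) (P.inst τ ρ.rhs) :=
  TRS.Rewrites.root (⟨Sum.inl ρ.root, fun i => (ρ.args i).mapSym P.trs.tupleHom,
    ρ.rhs.mapSym P.trs.tupleHom⟩ : Rule P.trs.tupleSig V) _ ⟨ρ, hρ, rfl⟩
    (isConstructorSubst_embed τ)

/-- The atoms of a clause body can be evaluated from left to right, below the symbols `u_{c,i}`. -/
theorem rewrites_body {c : P.clauses} {τ : Subst S V}
    (h : ∀ B ∈ c.1.body, Relation.ReflTransGen P.trs.lift.Rewrites
      (P.inInst (B.toInf.subst τ)) (P.outInst (B.toInf.subst τ)))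
    (i : ℕ) (hi : i < c.1.body.length) :
    Relation.ReflTransGen P.trs.lift.Rewrites (P.inInst (c.1.head.toInf.subst τ))
      (P.inst τ (P.uTerm c ⟨i, hi⟩ (P.outTerm c.1.body[i]))) := by
  have hu : ∀ i (hi : i < c.1.body.length), Relation.ReflTransGen P.trs.lift.Rewrites
      (P.inst τ (P.uTerm c ⟨i, hi⟩ (P.inTerm c.1.body[i])))
      (P.inst τ (P.uTerm c ⟨i, hi⟩ (P.outTerm c.1.body[i]))) := by
    intro i hi
    have hB := h _ (List.getElem_mem hi)
    rw [← inst_inTerm, ← inst_outTerm] at hB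
    rw [inst_uTerm, inst_uTerm]
    exact TRS.reflTransGen_rewrites_arg hB rfl (inst_uArgs_eq_update τ c ⟨i, hi⟩ _ _)
  induction i with
  | zero =>
    refine .trans (.single ?_) (hu 0 hi)
    rw [← inst_inTerm]
    exact rewrites_inst (IsTransformedRule.first c hi) τ
  | succ i ih =>
    exact ((ih (by omega)).tail (rewrites_inst (IsTransformedRule.next c i hi) τ)).trans
      (hu (i + 1) hi)

theorem Succeeds.rewrites {A : Atom D (Term S V)} (h : P.Succeeds A) :
    Relation.ReflTransGen P.trs.lift.Rewrites (P.inInst A) (P.outInst A) := by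
  induction h with
  | intro c τ _ ih =>
    rcases Nat.eq_zero_or_pos c.1.body.length with h0 | hpos
    · rw [← inst_inTerm, ← inst_outTerm]
      exact .single (rewrites_inst (IsTransformedRule.fact c (List.length_eq_zero_iff.1 h0)) τ)
    · have h := rewrites_inst (IsTransformedRule.last c (c.1.body.length - 1) (by omega)) τ
      rw [inst_outTerm] at h
      exact (rewrites_body ih (c.1.body.length - 1) (by omega)).tail h

/-! ### The chain of a non-terminating query -/

theorem pin_mem_definedSyms (c : P.clauses) :
    (ProgSym.pin c.1.head.pred : ProgSym P) ∈ P.trs.definedSyms := by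
  rcases Nat.eq_zero_or_pos c.1.body.length with h0 | hpos
  · exact ⟨_, IsTransformedRule.fact c (List.length_eq_zero_iff.1 h0), rfl⟩
  · exact ⟨_, IsTransformedRule.first c hpos, rfl⟩

theorem u_mem_definedSyms (c : P.clauses) (i : Fin c.1.body.length) :
    (ProgSym.u c i : ProgSym P) ∈ P.trs.definedSyms := by
  obtain ⟨i, hi⟩ := i
  rcases Nat.lt_or_ge (i + 1) c.1.body.length with h | h
  · exact ⟨_, IsTransformedRule.next c i h, rfl⟩
  · exact ⟨_, IsTransformedRule.last c i (by omega), rfl⟩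

variable (P) in
/-- `t` is an instance of `ℓ♯` for a rule `ℓ → u_{c,i+1}(Bᵢ_in, …)`, and the same instance of the
part of the body of `c` that starts with `Bᵢ` does not terminate. The body atoms are counted
from `0`, and the rule is one with left-hand side `H_in` if `i = 0` and `u_{c,i}(…)` otherwise. -/
def Live (t : Term P.trs.tupleSig V) : Prop :=
  ∃ (c : P.clauses) (i : ℕ) (hi : i < c.1.body.length) (ρ : Rule P.sig V) (hρ : ρ ∈ P.trs)
    (τ : Subst S V), ρ.rhs = P.uTerm c ⟨i, hi⟩ (P.inTerm c.1.body[i]) ∧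
      ¬ P.InstTerminates ((c.1.body.drop i).map fun B => B.toInf.subst τ) ∧
      t = (P.trs.sharp ⟨ρ.root, ρ, hρ, rfl⟩ ρ.args).toTerm.subst fun x => P.embed (τ x)

theorem live_inSharpInst {A : Atom D (Term S V)} (h : ¬ P.InstTerminates [A]) :
    ∃ hA, P.Live (P.inSharpInst A hA) := by
  obtain ⟨c, τ, rfl, hB⟩ := exists_clause_of_not_instTerminates h
  have hpos : 0 < c.1.body.length := by
    by_contra h0
    rw [List.length_eq_zero_iff.1 (Nat.eq_zero_of_not_pos h0)] at hB
    exact hB instTerminates_nil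
  refine ⟨pin_mem_definedSyms c, c, 0, hpos, _, IsTransformedRule.first c hpos, τ, rfl, hB, ?_⟩
  exact (sharp_argTerms_subst τ c.1.head _).symm

theorem live_uSharp {c : P.clauses} {i : ℕ} (hi : i < c.1.body.length) {τ : Subst S V}
    (h : ¬ P.InstTerminates ((c.1.body.drop (i + 1)).map fun B => B.toInf.subst τ)) :
    P.Live ((P.trs.sharp ⟨ProgSym.u c ⟨i, hi⟩, u_mem_definedSyms c _⟩
      (P.uArgs c ⟨i, hi⟩ (P.outTerm c.1.body[i]))).toTerm.subst fun x => P.embed (τ x)) := by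
  have hlt : i + 1 < c.1.body.length := by
    by_contra hge
    rw [List.drop_eq_nil_of_le (Nat.le_of_not_lt hge)] at h
    exact h instTerminates_nil
  exact ⟨c, i + 1, hlt, _, IsTransformedRule.next c i hlt, τ, rfl, h, rfl⟩

theorem reflTransGen_uSharp {c : P.clauses} {i : Fin c.1.body.length} {τ : Subst S V}
    {t t' : FinTerm P.sig V}
    (h : Relation.ReflTransGen P.trs.lift.Rewrites (P.inst τ t) (P.inst τ t')) :
    Relation.ReflTransGen P.trs.lift.Rewrites
      ((P.trs.sharp ⟨ProgSym.u c i, u_mem_definedSyms c i⟩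
        (P.uArgs c i t)).toTerm.subst fun x => P.embed (τ x))
      ((P.trs.sharp ⟨ProgSym.u c i, u_mem_definedSyms c i⟩
        (P.uArgs c i t')).toTerm.subst fun x => P.embed (τ x)) := by
  have hu := TRS.reflTransGen_rewrites_arg (S := P.trs.tupleSig)
    (f := Sum.inr ⟨ProgSym.u c i, u_mem_definedSyms c i⟩) h rfl
    (inst_uArgs_eq_update τ c i t t')
  exact Eq.subst (motive := fun s => Relation.ReflTransGen _ s _) (sharp_toTerm_subst τ _ _).symm
    (Eq.subst (sharp_toTerm_subst τ _ _).symm hu)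

/-- If the first atom `Bᵢ` of the non-terminating part of the body does not terminate, then the
dependency pair with right-hand side `Bᵢ_in♯` is used. Otherwise `Bᵢ` succeeds, and the dependency
pair with right-hand side `u_{c,i+1}♯(Bᵢ_in, …)` is used, followed by the evaluation of `Bᵢ_in`. -/
theorem Live.exists_pair {t : Term P.trs.tupleSig V} (h : P.Live t) :
    ∃ pair ∈ P.trs.DP, ∃ σ : Subst P.trs.tupleSig V, P.trs.lift.IsConstructorSubst σ ∧
      t = pair.lhs.toTerm.subst σ ∧ ∃ t', P.Live t' ∧
        Relation.ReflTransGen P.trs.lift.Rewrites (pair.rhs.toTerm.subst σ) t' := by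
  obtain ⟨c, i, hi, ρ, hρ, τ, hr, hnt, rfl⟩ := h
  rw [List.drop_eq_getElem_cons hi, List.map_cons] at hnt
  rcases not_instTerminates_cons hnt with hB | ⟨hB, hrest⟩
  · obtain ⟨hA, hlive⟩ := live_inSharpInst hB
    refine ⟨_, ⟨ρ, hρ, ⟨ProgSym.pin c.1.body[i].pred, hA⟩, P.argTerms c.1.body[i], ?_, rfl⟩, _,
      isConstructorSubst_embed τ, rfl, _, hlive, ?_⟩
    · rw [hr]
      exact .arg (S := P.sig) _ _ (0 : Fin (_ + 1)) .refl
    · change Relation.ReflTransGen _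
        ((P.trs.sharp ⟨ProgSym.pin c.1.body[i].pred, hA⟩
          (P.argTerms c.1.body[i])).toTerm.subst fun x => P.embed (τ x)) _
      rw [sharp_argTerms_subst τ c.1.body[i] hA]
  · refine ⟨_, ⟨ρ, hρ, ⟨ProgSym.u c ⟨i, hi⟩, u_mem_definedSyms c _⟩,
      P.uArgs c ⟨i, hi⟩ (P.inTerm c.1.body[i]), ?_, rfl⟩, _,
      isConstructorSubst_embed τ, rfl, _, live_uSharp hi hrest, ?_⟩
    · rw [hr]
      exact .refl
    · have hBr := hB.rewrites
      rw [← inst_inTerm, ← inst_outTerm] at hBr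
      exact reflTransGen_uSharp hBr

theorem Live.exists_isInfiniteChain {π : ArgFilter P.trs.tupleSig}
    (hDP : (π.filterTRS P.trs.DP).VariableCondition)
    (hR : (π.filterTRS P.trs.lift).VariableCondition) {t : Term P.trs.tupleSig V}
    (hlive : P.Live t) (ht : π.FiltersToGround t) :
    ∃ pair : ℕ → Rule P.trs.tupleSig V, TRS.IsInfiniteChain P.trs.DP P.trs.lift π pair := by
  have hstep : ∀ s : {t // P.Live t ∧ π.FiltersToGround t},
      ∃ s' : {t // P.Live t ∧ π.FiltersToGround t}, ∃ pair ∈ P.trs.DP,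
      ∃ σ : Subst P.trs.tupleSig V, P.trs.lift.IsConstructorSubst σ ∧
        s.1 = pair.lhs.toTerm.subst σ ∧ π.FiltersToGround (pair.rhs.toTerm.subst σ) ∧
        Relation.ReflTransGen (fun q q' => P.trs.lift.Rewrites q q' ∧ π.IsFiniteGround q')
          (pair.rhs.toTerm.subst σ) s'.1 := by
    rintro ⟨s, hs, hg⟩
    obtain ⟨pair, hpair, σ, hσ, rfl, s', hs', hrew⟩ := hs.exists_pair
    have hg' := hg.rhs hDP hpair
    have hrew' := hg'.reflTransGen hR hrew
    exact ⟨⟨s', hs', hrew'.1⟩, pair, hpair, σ, hσ, rfl, hg', hrew'.2⟩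
  choose next pair hpair σ hσ hl hr hrew using hstep
  let s : ℕ → {t // P.Live t ∧ π.FiltersToGround t} := fun n => next^[n] ⟨t, hlive, ht⟩
  have hs : ∀ i, s (i + 1) = next (s i) := fun i => Function.iterate_succ_apply' next i _
  refine ⟨fun i => pair (s i), fun i => hpair _, fun i => σ (s i), fun i => hσ _, fun i => ?_⟩
  refine ⟨?_, ArgFilter.isFiniteGround_iff.2 (hr _), ?_⟩
  · rw [← hl]
    exact ArgFilter.isFiniteGround_iff.2 (s i).2.2
  · rw [← hl, hs]
    exact hrew (s i)

theorem filtersToGround_embed_subst {π : ArgFilter S} {πD : ArgFilter D}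
    {π' : ArgFilter P.trs.tupleSig} (href : π'.IsRefinement (P.extendFilter π πD))
    (σ : Subst S V) {t : Term S V} (h : π.FiltersToGround t) :
    π'.FiltersToGround (P.embed (t.subst σ)) := by
  induction h with
  | app f ts _ ih =>
    rw [Term.subst_app, embed_app]
    exact .app _ _ fun i hi => ih i (href _ hi)

end LogicProgram

end LPTermination

theorem mainTheorem3 {V : Type*} [Infinite V]
    (S D : Signature) [Finite S.Sym] [Finite D.Sym] (hconst : ∃ f : S.Sym, S.arity f = 0)
    (P : LogicProgram S D V) (π : ArgFilter S) (πD : ArgFilter D)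
    (π' : ArgFilter P.trs.tupleSig) (href : π'.IsRefinement (P.extendFilter π πD))
    (hDP : (π'.filterTRS P.trs.DP).VariableCondition)
    (hR : (π'.filterTRS P.trs.lift).VariableCondition)
    (hchain : ¬ ∃ pair : ℕ → Rule P.trs.tupleSig V,
      TRS.IsInfiniteChain P.trs.DP P.trs.lift π' pair)
    (Q : Atom D (Term S V)) (hQrat : Q.IsRational)
    (hQ : (π.filterAtom πD Q).IsFiniteGround) :
    P.Terminates [Q] := by
  by_contra hnt
  obtain ⟨σ, hσ⟩ := LogicProgram.exists_not_instTerminates hnt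
  obtain ⟨hA, hlive⟩ := LogicProgram.live_inSharpInst hσ
  -- A position of `Q_in♯` kept by `π'` is a position kept by `πD`, where `π(Q)` has an argument.
  refine hchain (hlive.exists_isInfiniteChain hDP hR (.app _ _ fun i hi => ?_))
  obtain ⟨j, rfl⟩ := ArgFilter.exists_sel_eq (π := πD) (href _ hi)
  exact LogicProgram.filtersToGround_embed_subst href σ (ArgFilter.isFiniteGround_iff.1 (hQ j))
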